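/- Let $\mathbb{R}_{\max}=\mathbb{R}\cup\{-\infty\}$ with $a\oplus b=\max(a,b)$, $ab=a+b$, zero $\mathbb{0}=-\infty$ and unit $\mathbb{1}=0$, and let these operations act entrywise on $\mathbb{R}_{\max}^n$. A max-plus polyhedron is an intersection of finitely many affine half-spaces $$\Big\{x\in\mathbb{R}_{\max}^n : \big(\textstyle\bigoplus_i a_ix_i\big)\oplus c\le\big(\bigoplus_j b_jx_j\big)\oplus d\Big\},\qquad a,b\in\mathbb{R}_{\max}^n,\ c,d\in\mathbb{R}_{\max}.$$ For $X\subseteq\mathbb{R}_{\max}^n$ let $\mathrm{cone}(X)$ be the smallest set that contains $X$ and the zero vector and is stable under all combinations $\lambda u\oplus\mu v$ with $\lambda,\mu\in\mathbb{R}_{\max}$ (so $\mathrm{cone}(\emptyset)=\{\mathbb{0}\}$), and let $\mathrm{co}(X)$ be the smallest set that contains $X$ and is stable under those with $\lambda\oplus\mu=\mathbb{1}$ (so $\mathrm{co}(\emptyset)=\emptyset$). For sets let $A\oplus B=\{a\oplus b: a\in A,\ b\in B\}$. The recession cone of $C$ is the set of all $u$ for which there is $x\in C$ with $x\oplus\lambda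 u\in C$ for all $\lambda\in\mathbb{R}_{\max}$. An extreme vector of $V$ is a nonzero $v\in V$ such that $v=u\oplus w$ with $u,w\in V$ implies $v=u$ or $v=w$; the set of scalar multiples of $v$ is then an extreme ray of $V$. An extreme point of $C$ is a $v\in C$ such that $v=\lambda u\oplus\mu w$ with $u,w\in C$ and $\lambda\oplus\mu=\mathbb{1}$ implies $v=u$ or $v=w$. **Theorem (Tropical Minkowski–Weyl).** Let $n\ge 0$. 1. A set $C\subseteq\mathbb{R}_{\max}^n$ is a max-plus polyhedron if and only if $C=\mathrm{co}(Z)\oplus\mathrm{cone}(Y)$ for some finite sets $Z,Y\subseteq\mathbb{R}_{\max}^n$. 2. If $C$ is nonempty and $C=\mathrm{co}(Z)\oplus\mathrm{cone}(Y)$ with $Z,Y$ finite, then $\mathrm{cone}(Y)$ is the recession cone of $C$; in particular $\mathrm{cone}(Y)$ is the same for all such representations of $C$. 3. Let $C$ be a max-plus polyhedron. A set $Y$ is minimal for inclusion among the finite sets $Y$ that occur in a representation $C=\mathrm{co}(Z)\oplus\mathrm{cone}(Y)$ with $Z$ finite if and only if $Y$ is obtained by selecting precisely one nonzero vector in each extreme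 ray of the recession cone of $C$. 4. Let $C$ be a max-plus polyhedron. A set $Z$ is minimal for inclusion among the finite sets $Z$ that occur in a representation $C=\mathrm{co}(Z)\oplus\mathrm{cone}(Y)$ with $Y$ finite if and only if $Z$ is the set of extreme points of $C$. -/

import Mathlib

namespace MaxPlus

/-- The set `ℝ ∪ {-∞}` underlying the max-plus semiring. The max-plus sum of `a` and `b` is
`a ⊔ b`, their max-plus product is `a + b` (with `⊥ + a = ⊥`), the max-plus zero is `⊥ = -∞` and
the max-plus unit is the real number `0`. -/
abbrev Scalar : Type := WithBot ℝ

/-- The space of vectors with `n` max-plus entries. The max-plus sum of `u` and `v` is `u ⊔ v`,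
and the zero vector is `⊥`. The order is the entrywise one. -/
abbrev Vec (n : ℕ) : Type := Fin n → Scalar

/-- The max-plus multiple of a vector by a scalar. -/
def scale {n : ℕ} (t : Scalar) (v : Vec n) : Vec n := fun i => t + v i

/-- The max-plus scalar product, that is the maximum of all `a i + x i` (it is `-∞` if `n = 0`). -/
def dot {n : ℕ} (a x : Vec n) : Scalar := Finset.univ.sup fun i => a i + x i

/-- Max-plus cones: sets stable by max-plus linear combinations. They contain the zero vector,
the value of the empty linear combination. -/
def IsCone {n : ℕ} (V : Set (Vec n)) : Prop :=
  ⊥ ∈ V ∧ ∀ u ∈ V, ∀ v ∈ V, ∀ s t : Scalar, scale s u ⊔ scale t v ∈ V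

/-- Max-plus convex sets: sets stable by max-plus convex combinations. -/
def IsConvex {n : ℕ} (C : Set (Vec n)) : Prop :=
  ∀ u ∈ C, ∀ v ∈ C, ∀ s t : Scalar, s ⊔ t = 0 → scale s u ⊔ scale t v ∈ C

/-- The smallest max-plus cone containing `X`. -/
def cone {n : ℕ} (X : Set (Vec n)) : Set (Vec n) := ⋂₀ {V | IsCone V ∧ X ⊆ V}

/-- The smallest max-plus convex set containing `X`. -/
def co {n : ℕ} (X : Set (Vec n)) : Set (Vec n) := ⋂₀ {C | IsConvex C ∧ X ⊆ C}

/-- The max-plus Minkowski sum of two sets. -/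
def minkowskiSum {n : ℕ} (A B : Set (Vec n)) : Set (Vec n) := Set.image2 (fun u v => u ⊔ v) A B

/-- Affine half-spaces. -/
def IsAffineHalfSpace {n : ℕ} (H : Set (Vec n)) : Prop :=
  ∃ (a b : Vec n) (c d : Scalar), H = {x | dot a x ⊔ c ≤ dot b x ⊔ d}

/-- Max-plus polyhedra: intersections of finitely many affine half-spaces. -/
def IsPolyhedron {n : ℕ} (C : Set (Vec n)) : Prop :=
  ∃ S : Set (Set (Vec n)), S.Finite ∧ (∀ H ∈ S, IsAffineHalfSpace H) ∧ C = ⋂₀ S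

/-- `C` is represented by the finite set of points `Z` and the finite set of vectors `Y`. -/
def IsRepresentation {n : ℕ} (C Z Y : Set (Vec n)) : Prop :=
  Z.Finite ∧ Y.Finite ∧ C = minkowskiSum (co Z) (cone Y)

/-- The recession cone. -/
def recessionCone {n : ℕ} (C : Set (Vec n)) : Set (Vec n) :=
  {u | ∃ x ∈ C, ∀ t : Scalar, x ⊔ scale t u ∈ C}

/-- Extreme vectors of a max-plus cone. -/
def IsExtremeVector {n : ℕ} (V : Set (Vec n)) (v : Vec n) : Prop :=
  v ∈ V ∧ v ≠ ⊥ ∧ ∀ u ∈ V, ∀ w ∈ V, v = u ⊔ w → v = u ∨ v = w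

/-- Extreme rays of a max-plus cone: the sets of all scalar multiples of an extreme vector. -/
def IsExtremeRay {n : ℕ} (V R : Set (Vec n)) : Prop :=
  ∃ v, IsExtremeVector V v ∧ R = {x | ∃ t : Scalar, x = scale t v}

/-- `Y` is obtained by selecting precisely one nonzero vector in each extreme ray of `V`. -/
def IsExtremeRaySelection {n : ℕ} (V Y : Set (Vec n)) : Prop :=
  (∀ y ∈ Y, y ≠ ⊥ ∧ ∃ R, IsExtremeRay V R ∧ y ∈ R) ∧
    ∀ R, IsExtremeRay V R → ∃! y, y ∈ Y ∧ y ∈ R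

/-- The set of extreme points of a max-plus convex set. -/
def extremePoints {n : ℕ} (C : Set (Vec n)) : Set (Vec n) :=
  {v | v ∈ C ∧ ∀ u ∈ C, ∀ w ∈ C, ∀ s t : Scalar, s ⊔ t = 0 →
    v = scale s u ⊔ scale t w → v = u ∨ v = w}

end MaxPlus

/-!
The theorem is first proved for cones. Intersecting a cone generated by `G` with a half-space
`a x ≤ b x` gives the cone generated by the elements of `G` in the half-space and, for each `g`
inside and each `h` outside, by the combination `(a h) g ⊕ (b g) h`, at which the inequality is
an equality (`exists_coneHull_eq_inter_halfSpace`). So polyhedral cones are finitely generated.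
Conversely, a vector outside a finitely generated cone is separated from it by a half-space
(`exists_halfSpace_of_notMem_coneHull`): by `mem_coneHull_iff` some finite entry `x i` is
not attained by any multiple below `x` of a generator `g`, and for each `g` a single entry `k`
witnesses it, which yields one monomial of the right-hand side. The pairs `(a, b)` defining
half-spaces that contain the cone form a polyhedral cone in twice the dimension, and by the first
half finitely many of them generate all the others and hence describe the given cone
(`exists_iInter_halfSpace_eq_coneHull`). Homogenization transfers both directions to polyhedra
and sums `co Z ⊕ cone Y` (`homogenize_mem_coneHull_iff`).

If `x ⊕ r u` lies in `co Z ⊕ cone Y` for all `r`, then for large `r` the finite entries of `u` can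
only come from `cone Y`, which by `mem_coneHull_iff` puts `u` in this cone
(`cone_eq_recessionCone`).

For minimality, the tropical feature is that a vector whose coefficient is negative in a
combination equal to itself can be left out (`eq_comb_erase_sup`). Hence the elements of a minimal
`Y` or `Z` are extreme: writing such an element as a combination of two members of the cone or of
the convex set, its own coefficient cannot be negative, so it lies below one of the two members and
equals it. Conversely extreme vectors and extreme points occur, the former up to scaling, in every
generating set.
-/

namespace MaxPlus

variable {ι : Type*}

/-! ### Scalars and linear combinations -/

theorem coe_add_neg_coe_add (r : ℝ) (s : Scalar) : (r : Scalar) + (((-r : ℝ) : Scalar) + s) = s := by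
  rw [← add_assoc, ← WithBot.coe_add, add_neg_cancel, WithBot.coe_zero, zero_add]

theorem neg_coe_add_coe_add (r : ℝ) (s : Scalar) : ((-r : ℝ) : Scalar) + ((r : Scalar) + s) = s := by
  rw [← add_assoc, ← WithBot.coe_add, neg_add_cancel, WithBot.coe_zero, zero_add]

theorem vadd_sup (t : Scalar) (u v : ι → Scalar) : t +ᵥ (u ⊔ v) = (t +ᵥ u) ⊔ (t +ᵥ v) := by
  funext i
  exact add_max t (u i) (v i)

theorem sup_vadd (s t : Scalar) (v : ι → Scalar) : (s ⊔ t) +ᵥ v = (s +ᵥ v) ⊔ (t +ᵥ v) := by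
  funext i
  exact max_add s t (v i)

theorem vadd_bot (t : Scalar) : t +ᵥ (⊥ : ι → Scalar) = ⊥ := by
  funext i
  exact WithBot.add_bot t

theorem bot_vadd (v : ι → Scalar) : (⊥ : Scalar) +ᵥ v = ⊥ := by
  funext i
  exact WithBot.bot_add (v i)

theorem vadd_le_vadd {s t : Scalar} (h : s ≤ t) (v : ι → Scalar) : s +ᵥ v ≤ t +ᵥ v :=
  fun i => add_le_add_left h (v i)

theorem coe_vadd_neg_coe_vadd (r : ℝ) (v : ι → Scalar) :
    (r : Scalar) +ᵥ (((-r : ℝ) : Scalar) +ᵥ v) = v := by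
  funext i
  exact coe_add_neg_coe_add r (v i)

theorem neg_coe_vadd_coe_vadd (r : ℝ) (v : ι → Scalar) :
    ((-r : ℝ) : Scalar) +ᵥ ((r : Scalar) +ᵥ v) = v := by
  funext i
  exact neg_coe_add_coe_add r (v i)

theorem scale_eq_vadd {n : ℕ} (t : Scalar) (v : Vec n) : scale t v = t +ᵥ v := rfl

theorem add_finset_sup {κ : Type*} (S : Finset κ) (t : Scalar) (f : κ → Scalar) :
    t + S.sup f = S.sup fun k => t + f k :=
  Finset.apply_sup_eq_sup_comp (t + ·) (fun a b => add_max t a b) (WithBot.add_bot t)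

/-- The max-plus linear combination of the elements `g` of `G` with coefficients `c g`. The action
`t +ᵥ v`, which adds `t` to all entries of `v`, is the max-plus multiplication by `t`. -/
def comb (G : Finset (ι → Scalar)) (c : (ι → Scalar) → Scalar) : ι → Scalar :=
  G.sup fun g => c g +ᵥ g

theorem comb_apply (G : Finset (ι → Scalar)) (c : (ι → Scalar) → Scalar) (i : ι) :
    comb G c i = G.sup fun g => c g + g i := by
  rw [comb, Finset.sup_apply]
  rfl

theorem vadd_le_comb {G : Finset (ι → Scalar)} {g : ι → Scalar} (hg : g ∈ G)
    (c : (ι → Scalar) → Scalar) : c g +ᵥ g ≤ comb G c :=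
  Finset.le_sup (f := fun g => c g +ᵥ g) hg

theorem comb_sup (G : Finset (ι → Scalar)) (c d : (ι → Scalar) → Scalar) :
    comb G (c ⊔ d) = comb G c ⊔ comb G d := by
  simp only [comb, Pi.sup_apply, sup_vadd]
  exact Finset.sup_sup

theorem comb_vadd (G : Finset (ι → Scalar)) (t : Scalar) (c : (ι → Scalar) → Scalar) :
    comb G (t +ᵥ c) = t +ᵥ comb G c := by
  funext i
  rw [Pi.vadd_apply, vadd_eq_add, comb_apply, comb_apply, add_finset_sup]
  simp only [Pi.vadd_apply, vadd_eq_add, add_assoc]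

/-- A vector occurring with a negative coefficient in a combination equal to itself can be left
out of this combination. -/
theorem eq_comb_erase_sup [DecidableEq (ι → Scalar)] {G : Finset (ι → Scalar)} {g r : ι → Scalar}
    {c : (ι → Scalar) → Scalar} (hg : g ∈ G) (hc : c g < 0) (h : g = comb G c ⊔ r) :
    g = comb (G.erase g) c ⊔ r := by
  have h1 : g = (c g +ᵥ g) ⊔ (comb (G.erase g) c ⊔ r) := by
    rw [← sup_assoc]
    conv_lhs => rw [h, ← Finset.insert_erase hg, comb, Finset.sup_insert]
    rfl
  set q := comb (G.erase g) c ⊔ r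
  funext i
  have h2 : g i = (c g + g i) ⊔ q i := congrFun h1 i
  rcases eq_or_ne (g i) ⊥ with hb | hb
  · have : q i ≤ g i := h2 ▸ le_sup_right
    rw [hb] at this ⊢
    exact (le_bot_iff.mp this).symm
  · have h3 : c g + g i < g i := by
      have := WithBot.add_lt_add_right hb hc
      rwa [zero_add] at this
    rcases max_choice (c g + g i) (q i) with h4 | h4
    · exact absurd (h2.trans h4) h3.ne'
    · exact h2.trans h4

/-! ### Finitely generated cones -/

/-- The max-plus cone generated by a finite set of vectors with entries indexed by any type, as
the set of linear combinations of its generators. -/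
def coneHull (G : Finset (ι → Scalar)) : Set (ι → Scalar) := Set.range (comb G)

theorem bot_mem_coneHull (G : Finset (ι → Scalar)) : ⊥ ∈ coneHull G :=
  ⟨fun _ => ⊥, by simp [comb, bot_vadd]⟩

theorem sup_mem_coneHull {G : Finset (ι → Scalar)} {u v : ι → Scalar} (hu : u ∈ coneHull G)
    (hv : v ∈ coneHull G) : u ⊔ v ∈ coneHull G := by
  obtain ⟨c, rfl⟩ := hu
  obtain ⟨d, rfl⟩ := hv
  exact ⟨c ⊔ d, comb_sup G c d⟩

theorem vadd_mem_coneHull {G : Finset (ι → Scalar)} {u : ι → Scalar} (t : Scalar)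
    (hu : u ∈ coneHull G) : t +ᵥ u ∈ coneHull G := by
  obtain ⟨c, rfl⟩ := hu
  exact ⟨t +ᵥ c, comb_vadd G t c⟩

theorem finset_sup_mem_coneHull {κ : Type*} {G : Finset (ι → Scalar)} {S : Finset κ}
    {f : κ → ι → Scalar} (h : ∀ k ∈ S, f k ∈ coneHull G) : S.sup f ∈ coneHull G :=
  Finset.sup_mem _ (bot_mem_coneHull G) (fun _ hu _ hv => sup_mem_coneHull hu hv) S f h

theorem mem_coneHull_of_mem {G : Finset (ι → Scalar)} {g : ι → Scalar} (hg : g ∈ G) :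
    g ∈ coneHull G := by
  classical
  refine ⟨fun h => if h = g then 0 else ⊥, le_antisymm (Finset.sup_le fun h _ => ?_) ?_⟩
  · dsimp only
    split_ifs with h1
    · rw [h1, zero_vadd]
    · rw [bot_vadd]
      exact bot_le
  · have := vadd_le_comb hg (fun h => if h = g then 0 else ⊥)
    simpa using this

theorem coneHull_subset {G : Finset (ι → Scalar)} {K : Set (ι → Scalar)} (hbot : ⊥ ∈ K)
    (hsup : ∀ u ∈ K, ∀ v ∈ K, u ⊔ v ∈ K) (hvadd : ∀ t : Scalar, ∀ u ∈ K, t +ᵥ u ∈ K)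
    (hG : ∀ g ∈ G, g ∈ K) : coneHull G ⊆ K := by
  rintro _ ⟨c, rfl⟩
  exact Finset.sup_mem K hbot hsup G _ fun g hg => hvadd _ _ (hG g hg)

theorem coneHull_subset_coneHull {G H : Finset (ι → Scalar)} (h : ∀ g ∈ G, g ∈ coneHull H) :
    coneHull G ⊆ coneHull H :=
  coneHull_subset (bot_mem_coneHull H) (fun _ hu _ hv => sup_mem_coneHull hu hv)
    (fun t _ hu => vadd_mem_coneHull t hu) h

/-- A vector belongs to a finitely generated cone as soon as each of its finite entries is the
entry of some multiple of a generator lying below the vector. -/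
theorem mem_coneHull_iff [Fintype ι] {G : Finset (ι → Scalar)} {x : ι → Scalar} :
    x ∈ coneHull G ↔ ∀ i, x i ≠ ⊥ → ∃ g ∈ G, ∃ t : Scalar, t + g i = x i ∧ t +ᵥ g ≤ x := by
  constructor
  · rintro ⟨c, rfl⟩ i hi
    have hne : G.Nonempty := by
      rw [Finset.nonempty_iff_ne_empty]
      rintro rfl
      exact hi (by simp [comb])
    obtain ⟨g, hg, h⟩ := Finset.exists_mem_eq_sup G hne fun g => c g + g i
    exact ⟨g, hg, c g, by rw [comb_apply, h], vadd_le_comb hg c⟩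
  · intro h
    have h' : ∀ i, ∃ y ∈ coneHull G, y i = x i ∧ y ≤ x := by
      intro i
      by_cases hi : x i = ⊥
      · exact ⟨⊥, bot_mem_coneHull G, hi.symm, bot_le⟩
      · obtain ⟨g, hg, t, h1, h2⟩ := h i hi
        exact ⟨t +ᵥ g, vadd_mem_coneHull t (mem_coneHull_of_mem hg), h1, h2⟩
    choose y hy hyi hyx using h'
    have : x = Finset.univ.sup y := by
      refine le_antisymm (fun i => ?_) (Finset.sup_le fun i _ => hyx i)
      rw [← hyi i]
      exact Finset.le_sup (f := y) (Finset.mem_univ i) i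
    rw [this]
    exact finset_sup_mem_coneHull fun i _ => hy i

/-! ### Linear half-spaces -/

/-- The max-plus scalar product of vectors with entries indexed by any finite type. -/
def pairing [Fintype ι] (a x : ι → Scalar) : Scalar := Finset.univ.sup fun i => a i + x i

section Pairing

variable [Fintype ι]

theorem le_pairing (a x : ι → Scalar) (i : ι) : a i + x i ≤ pairing a x :=
  Finset.le_sup (f := fun i => a i + x i) (Finset.mem_univ i)

theorem pairing_comm (a x : ι → Scalar) : pairing a x = pairing x a := by
  simp only [pairing, add_comm]

theorem pairing_bot (a : ι → Scalar) : pairing a ⊥ = ⊥ := by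
  simp [pairing]

theorem pairing_sup (a x y : ι → Scalar) : pairing a (x ⊔ y) = pairing a x ⊔ pairing a y := by
  simp only [pairing, Pi.sup_apply, add_max]
  exact Finset.sup_sup

theorem pairing_vadd (a : ι → Scalar) (t : Scalar) (x : ι → Scalar) :
    pairing a (t +ᵥ x) = t + pairing a x := by
  simp only [pairing, add_finset_sup, Pi.vadd_apply, vadd_eq_add, add_left_comm]

theorem pairing_finset_sup {κ : Type*} (a : ι → Scalar) (S : Finset κ) (f : κ → ι → Scalar) :
    pairing a (S.sup f) = S.sup fun k => pairing a (f k) :=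
  Finset.apply_sup_eq_sup_comp (pairing a) (pairing_sup a) (pairing_bot a)

theorem pairing_comb (a : ι → Scalar) (G : Finset (ι → Scalar)) (c : (ι → Scalar) → Scalar) :
    pairing a (comb G c) = G.sup fun g => c g + pairing a g := by
  simp only [comb, pairing_finset_sup, pairing_vadd]

theorem coneHull_subset_halfSpace {G : Finset (ι → Scalar)} {a b : ι → Scalar}
    (h : ∀ g ∈ G, pairing a g ≤ pairing b g) :
    coneHull G ⊆ {x | pairing a x ≤ pairing b x} := by
  refine coneHull_subset ?_ ?_ ?_ h
  · simp [pairing_bot]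
  · intro u hu v hv
    simp only [Set.mem_ofPred_eq, pairing_sup] at *
    exact sup_le_sup hu hv
  · intro t u hu
    simp only [Set.mem_ofPred_eq, pairing_vadd] at *
    exact add_le_add_right hu t

theorem pairing_single [DecidableEq ι] (i : ι) (t : Scalar) (x : ι → Scalar) :
    pairing (fun j => if j = i then t else ⊥) x = t + x i := by
  refine le_antisymm (Finset.sup_le fun j _ => ?_) ?_
  · dsimp only
    split_ifs with h
    · rw [h]
    · rw [WithBot.bot_add]
      exact bot_le
  · simpa using le_pairing (fun j => if j = i then t else ⊥) x i

/-- The elementary step of the double description method: the generators of the intersection of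
a cone with a half-space are the old generators in the half-space, and the combinations, tight
for the half-space, of a generator inside with one outside. -/
theorem exists_coneHull_eq_inter_halfSpace (G : Finset (ι → Scalar)) (a b : ι → Scalar) :
    ∃ H : Finset (ι → Scalar),
      coneHull H = {x | x ∈ coneHull G ∧ pairing a x ≤ pairing b x} := by
  classical
  set P := G.filter fun g => pairing a g ≤ pairing b g with hP
  set N := G.filter fun g => ¬ pairing a g ≤ pairing b g with hN
  set w : (ι → Scalar) → (ι → Scalar) → ι → Scalar :=
    fun g h => (pairing a h +ᵥ g) ⊔ (pairing b g +ᵥ h) with hw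
  refine ⟨P ∪ Finset.image₂ w P N, Set.Subset.antisymm ?_ ?_⟩
  · refine Set.subset_inter (coneHull_subset_coneHull ?_) (coneHull_subset_halfSpace ?_)
    · intro x hx
      rcases Finset.mem_union.mp hx with hx | hx
      · exact mem_coneHull_of_mem (Finset.mem_filter.mp hx).1
      · obtain ⟨g, hg, h, hh, rfl⟩ := Finset.mem_image₂.mp hx
        exact sup_mem_coneHull
          (vadd_mem_coneHull _ (mem_coneHull_of_mem (Finset.mem_filter.mp hg).1))
          (vadd_mem_coneHull _ (mem_coneHull_of_mem (Finset.mem_filter.mp hh).1))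
    · intro x hx
      rcases Finset.mem_union.mp hx with hx | hx
      · exact (Finset.mem_filter.mp hx).2
      · obtain ⟨g, hg, h, hh, rfl⟩ := Finset.mem_image₂.mp hx
        simp only [hw, pairing_sup, pairing_vadd]
        rw [add_comm (pairing b g) (pairing a h)]
        exact (sup_le (add_le_add_right (Finset.mem_filter.mp hg).2 _) le_rfl).trans le_sup_left
  · rintro _ ⟨⟨c, rfl⟩, hx⟩
    rcases G.eq_empty_or_nonempty with rfl | hne
    · simpa [comb] using bot_mem_coneHull _
    obtain ⟨g, hg, hgb⟩ := Finset.exists_mem_eq_sup G hne fun g => c g + pairing b g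
    rw [pairing_comb a, pairing_comb b, hgb] at hx
    have hle : ∀ h ∈ G, c h + pairing a h ≤ c g + pairing b g := fun h hh =>
      (Finset.le_sup (f := fun h => c h + pairing a h) hh).trans hx
    have hfin : ∀ h ∈ G, ¬ pairing a h ≤ pairing b h → ∃ r : ℝ, (r : Scalar) = pairing a h :=
      fun h _ hn => WithBot.ne_bot_iff_exists.mp fun h0 => hn (h0 ▸ bot_le)
    by_cases hbot : c g + pairing b g = ⊥
    · -- Here all generators outside the half-space have the coefficient `⊥`.
      refine finset_sup_mem_coneHull fun h hh => ?_
      by_cases hn : pairing a h ≤ pairing b h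
      · exact vadd_mem_coneHull _ (mem_coneHull_of_mem
          (Finset.mem_union_left _ (Finset.mem_filter.mpr ⟨hh, hn⟩)))
      · have h1 := hle h hh
        obtain ⟨r, hr⟩ := hfin h hh hn
        rw [hbot, le_bot_iff, WithBot.add_eq_bot, ← hr] at h1
        rw [h1.resolve_right WithBot.coe_ne_bot, bot_vadd]
        exact bot_mem_coneHull _
    · obtain ⟨hcg, hbg⟩ : c g ≠ ⊥ ∧ pairing b g ≠ ⊥ := by
        simpa [WithBot.add_eq_bot] using hbot
      obtain ⟨β, hβ⟩ := WithBot.ne_bot_iff_exists.mp hbg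
      have hgood : pairing a g ≤ pairing b g := by
        by_contra hn
        exact absurd (hle g hg) (not_le.mpr (WithBot.add_lt_add_left hcg (not_le.mp hn)))
      have hgP : g ∈ P := Finset.mem_filter.mpr ⟨hg, hgood⟩
      have hgm := vadd_mem_coneHull (c g) (mem_coneHull_of_mem
        (Finset.mem_union_left (Finset.image₂ w P N) hgP))
      have hsum : comb G c = G.sup fun h => (c g +ᵥ g) ⊔ (c h +ᵥ h) :=
        le_antisymm (Finset.sup_mono_fun fun h _ => le_sup_right)
          (Finset.sup_le fun h hh => sup_le (vadd_le_comb hg c) (vadd_le_comb hh c))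
      rw [hsum]
      refine finset_sup_mem_coneHull fun h hh => ?_
      by_cases hn : pairing a h ≤ pairing b h
      · exact sup_mem_coneHull hgm (vadd_mem_coneHull _ (mem_coneHull_of_mem
          (Finset.mem_union_left _ (Finset.mem_filter.mpr ⟨hh, hn⟩))))
      · have key : (c g +ᵥ g) ⊔ (c h +ᵥ h) =
            (c g +ᵥ g) ⊔ ((((-β : ℝ) : Scalar) + c h) +ᵥ w g h) := by
          have e1 : (((-β : ℝ) : Scalar) + c h) +ᵥ (pairing b g +ᵥ h) = c h +ᵥ h := by
            rw [← hβ, vadd_vadd, add_right_comm, ← WithBot.coe_add, neg_add_cancel,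
              WithBot.coe_zero, zero_add]
          have e2 : (((-β : ℝ) : Scalar) + c h) +ᵥ (pairing a h +ᵥ g) ≤ c g +ᵥ g := by
            rw [vadd_vadd, add_assoc]
            refine vadd_le_vadd ?_ g
            have := add_le_add_right (hle h hh) ((-β : ℝ) : Scalar)
            rwa [add_comm (c g), ← hβ, neg_coe_add_coe_add] at this
          simp only [hw, vadd_sup]
          rw [e1, ← sup_assoc, sup_eq_left.mpr e2]
        rw [key]
        exact sup_mem_coneHull hgm (vadd_mem_coneHull _ (mem_coneHull_of_mem
          (Finset.mem_union_right _ (Finset.mem_image₂_of_mem hgP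
            (Finset.mem_filter.mpr ⟨hh, hn⟩)))))

/-- Finite intersections of linear half-spaces are finitely generated cones. -/
theorem exists_coneHull_eq_iInter_halfSpace
    (S : Finset ((ι → Scalar) × (ι → Scalar))) :
    ∃ G : Finset (ι → Scalar),
      coneHull G = {x | ∀ p ∈ S, pairing p.1 x ≤ pairing p.2 x} := by
  classical
  induction S using Finset.induction_on with
  | empty =>
    refine ⟨Finset.univ.image fun i j => if j = i then 0 else ⊥, ?_⟩
    simp only [Finset.notMem_empty, false_imp_iff, implies_true, Set.ofPred_true]
    refine Set.eq_univ_of_forall fun x => mem_coneHull_iff.mpr fun i _ =>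
      ⟨_, Finset.mem_image_of_mem _ (Finset.mem_univ i), x i, by simp, fun j => ?_⟩
    by_cases h : j = i <;> simp [h]
  | insert p S _ ih =>
    obtain ⟨G, hG⟩ := ih
    obtain ⟨H, hH⟩ := exists_coneHull_eq_inter_halfSpace G p.1 p.2
    refine ⟨H, ?_⟩
    rw [hH, hG]
    ext x
    simp only [Set.mem_ofPred_eq, Finset.mem_insert, forall_eq_or_imp]
    exact and_comm

/-- Separation of a vector from a finitely generated cone by a half-space. -/
theorem exists_halfSpace_of_notMem_coneHull {G : Finset (ι → Scalar)} {x : ι → Scalar}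
    (hx : x ∉ coneHull G) :
    ∃ a b : ι → Scalar, (∀ g ∈ G, pairing a g ≤ pairing b g) ∧ pairing b x < pairing a x := by
  classical
  rw [mem_coneHull_iff] at hx
  push Not at hx
  obtain ⟨i, hi, h⟩ := hx
  -- The half-space is given by `y i ≤ b y`, where `b` is the maximum of one monomial for each
  -- generator `g`; this monomial equals `g i` at `g` and is less than `x i` at `x`.
  have h' : ∀ g ∈ G, ∃ b : ι → Scalar, g i ≤ pairing b g ∧ pairing b x < x i := by
    intro g hg
    rcases eq_or_ne (g i) ⊥ with hgi | hgi
    · refine ⟨⊥, hgi ▸ bot_le, ?_⟩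
      rw [pairing_comm, pairing_bot]
      exact bot_lt_iff_ne_bot.mpr hi
    · obtain ⟨γ, hγ⟩ := WithBot.ne_bot_iff_exists.mp hgi
      obtain ⟨ξ, hξ⟩ := WithBot.ne_bot_iff_exists.mp hi
      have h1 := h g hg ((ξ - γ : ℝ) : Scalar) (by
        rw [← hγ, ← hξ, ← WithBot.coe_add, sub_add_cancel])
      simp only [Pi.le_def, not_forall, not_le, Pi.vadd_apply, vadd_eq_add] at h1
      obtain ⟨k, hk⟩ := h1
      have hgk : g k ≠ ⊥ := fun h0 => by simp [h0] at hk
      obtain ⟨κ, hκ⟩ := WithBot.ne_bot_iff_exists.mp hgk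
      refine ⟨fun j => if j = k then ((γ - κ : ℝ) : Scalar) else ⊥, ?_, ?_⟩
      · rw [pairing_single, ← hγ, ← hκ, ← WithBot.coe_add, sub_add_cancel]
      · rw [pairing_single, ← hξ]
        rw [← hκ] at hk
        rcases eq_or_ne (x k) ⊥ with h0 | h0
        · rw [h0, WithBot.add_bot]
          exact WithBot.bot_lt_coe _
        · obtain ⟨η, hη⟩ := WithBot.ne_bot_iff_exists.mp h0
          rw [← hη] at hk ⊢
          norm_cast at hk ⊢
          linarith
  choose! b hb1 hb2 using h'
  refine ⟨fun j => if j = i then 0 else ⊥, G.sup b, fun g hg => ?_, ?_⟩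
  · rw [pairing_single, zero_add]
    refine (hb1 g hg).trans ?_
    rw [pairing_comm, pairing_comm (G.sup b), pairing_finset_sup]
    exact Finset.le_sup (f := fun k => pairing g (b k)) hg
  · rw [pairing_single, zero_add, pairing_comm, pairing_finset_sup,
      Finset.sup_lt_iff (bot_lt_iff_ne_bot.mpr hi)]
    intro g hg
    rw [pairing_comm]
    exact hb2 g hg

theorem pairing_sum_elim {κ : Type*} [Fintype κ] (a : ι → Scalar) (b : κ → Scalar)
    (w : ι ⊕ κ → Scalar) :
    pairing (Sum.elim a b) w = pairing a (w ∘ Sum.inl) ⊔ pairing b (w ∘ Sum.inr) := by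
  refine le_antisymm (Finset.sup_le ?_) (sup_le (Finset.sup_le ?_) (Finset.sup_le ?_))
  · rintro (i | i) _
    · exact (le_pairing a (w ∘ Sum.inl) i).trans le_sup_left
    · exact (le_pairing b (w ∘ Sum.inr) i).trans le_sup_right
  · exact fun i _ => le_pairing (Sum.elim a b) w (Sum.inl i)
  · exact fun i _ => le_pairing (Sum.elim a b) w (Sum.inr i)

/-- Finitely generated cones are finite intersections of linear half-spaces: the half-spaces
containing the generators form a polyhedral cone, whose finitely many generators suffice to
describe the given cone. -/
theorem exists_iInter_halfSpace_eq_coneHull (G : Finset (ι → Scalar)) :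
    ∃ S : Finset ((ι → Scalar) × (ι → Scalar)),
      coneHull G = {x | ∀ p ∈ S, pairing p.1 x ≤ pairing p.2 x} := by
  classical
  obtain ⟨W, hW⟩ := exists_coneHull_eq_iInter_halfSpace
    (G.image fun g => ((Sum.elim g ⊥, Sum.elim ⊥ g) : (ι ⊕ ι → Scalar) × (ι ⊕ ι → Scalar)))
  have hW' : ∀ w, w ∈ coneHull W ↔
      ∀ g ∈ G, pairing (w ∘ Sum.inl) g ≤ pairing (w ∘ Sum.inr) g := by
    intro w
    rw [hW]
    simp only [Set.mem_ofPred_eq, Finset.forall_mem_image, pairing_sum_elim,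
      pairing_comm (⊥ : ι → Scalar), pairing_bot, bot_sup_eq, sup_bot_eq, pairing_comm _ (w ∘ _)]
  refine ⟨W.image fun w => (w ∘ Sum.inl, w ∘ Sum.inr), Set.Subset.antisymm ?_ ?_⟩
  · intro x hx p hp
    obtain ⟨w, hw, rfl⟩ := Finset.mem_image.mp hp
    exact coneHull_subset_halfSpace ((hW' w).mp (mem_coneHull_of_mem hw)) hx
  · intro x hx
    by_contra hn
    obtain ⟨a, b, h1, h2⟩ := exists_halfSpace_of_notMem_coneHull hn
    have h3 : Sum.elim a b ∈ coneHull W := (hW' _).mpr (by simpa using h1)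
    have h4 : pairing (Sum.elim x ⊥) (Sum.elim a b) ≤ pairing (Sum.elim ⊥ x) (Sum.elim a b) := by
      refine coneHull_subset_halfSpace (fun w hw => ?_) h3
      have := hx _ (Finset.mem_image_of_mem _ hw)
      simpa only [pairing_sum_elim, pairing_comm (⊥ : ι → Scalar), pairing_bot, bot_sup_eq,
        sup_bot_eq, pairing_comm x] using this
    simp only [pairing_sum_elim, pairing_comm (⊥ : ι → Scalar), pairing_bot, bot_sup_eq,
      sup_bot_eq, pairing_comm x, Sum.elim_comp_inl, Sum.elim_comp_inr] at h4
    exact absurd h4 (not_le.mpr h2)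

end Pairing

/-! ### Convex hulls, cones and their Minkowski sums -/

theorem isCone_coneHull {n : ℕ} (G : Finset (Vec n)) : IsCone (coneHull G) :=
  ⟨bot_mem_coneHull G, fun _ hu _ hv s t =>
    sup_mem_coneHull (vadd_mem_coneHull s hu) (vadd_mem_coneHull t hv)⟩

theorem isCone_cone {n : ℕ} (X : Set (Vec n)) : IsCone (cone X) :=
  ⟨fun _ hV => hV.1.1, fun u hu v hv s t V hV => hV.1.2 u (hu V hV) v (hv V hV) s t⟩

theorem subset_cone {n : ℕ} (X : Set (Vec n)) : X ⊆ cone X := fun _ hx _ hV => hV.2 hx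

theorem cone_subset {n : ℕ} {X V : Set (Vec n)} (hV : IsCone V) (h : X ⊆ V) : cone X ⊆ V :=
  Set.sInter_subset_of_mem ⟨hV, h⟩

theorem IsCone.scale_mem {n : ℕ} {V : Set (Vec n)} (hV : IsCone V) {v : Vec n} (hv : v ∈ V)
    (t : Scalar) : scale t v ∈ V := by
  have := hV.2 v hv v hv t t
  rwa [sup_idem] at this

theorem IsCone.sup_mem {n : ℕ} {V : Set (Vec n)} (hV : IsCone V) {u v : Vec n} (hu : u ∈ V)
    (hv : v ∈ V) : u ⊔ v ∈ V := by
  have := hV.2 u hu v hv 0 0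
  rwa [scale_eq_vadd, scale_eq_vadd, zero_vadd, zero_vadd] at this

theorem cone_coe {n : ℕ} (Y : Finset (Vec n)) : cone (Y : Set (Vec n)) = coneHull Y := by
  refine Set.Subset.antisymm
    (cone_subset (isCone_coneHull Y) fun _ hy => mem_coneHull_of_mem hy) ?_
  have h := isCone_cone (Y : Set (Vec n))
  exact coneHull_subset h.1 (fun _ hu _ hv => h.sup_mem hu hv) (fun t _ hu => h.scale_mem hu t)
    fun _ hy => subset_cone _ hy

theorem isConvex_co {n : ℕ} (X : Set (Vec n)) : IsConvex (co X) :=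
  fun u hu v hv s t hst V hV => hV.1 u (hu V hV) v (hv V hV) s t hst

theorem subset_co {n : ℕ} (X : Set (Vec n)) : X ⊆ co X := fun _ hx _ hV => hV.2 hx

theorem co_subset {n : ℕ} {X C : Set (Vec n)} (hC : IsConvex C) (h : X ⊆ C) : co X ⊆ C :=
  Set.sInter_subset_of_mem ⟨hC, h⟩

theorem co_empty {n : ℕ} : co (∅ : Set (Vec n)) = ∅ :=
  Set.subset_empty_iff.mp (co_subset (fun _ hu => hu.elim) (Set.empty_subset _))

theorem exists_mem_eq_zero_of_sup_eq_zero {κ : Type*} {Z : Finset κ} {c : κ → Scalar}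
    (hc : Z.sup c = 0) : ∃ z ∈ Z, c z = 0 := by
  have hne : Z.Nonempty := by
    rw [Finset.nonempty_iff_ne_empty]
    rintro rfl
    exact absurd hc (by simp)
  obtain ⟨z, hz, h⟩ := Finset.exists_mem_eq_sup Z hne c
  exact ⟨z, hz, h ▸ hc⟩

theorem IsConvex.sup_scale_mem {n : ℕ} {C : Set (Vec n)} (hC : IsConvex C) {u v : Vec n}
    (hu : u ∈ C) (hv : v ∈ C) {t : Scalar} (ht : t ≤ 0) : u ⊔ (t +ᵥ v) ∈ C := by
  have := hC u hu v hv 0 t (sup_eq_left.mpr ht)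
  rwa [scale_eq_vadd, scale_eq_vadd, zero_vadd] at this

theorem co_coe {n : ℕ} (Z : Finset (Vec n)) :
    co (Z : Set (Vec n)) = {x | ∃ c, Z.sup c = 0 ∧ x = comb Z c} := by
  classical
  refine Set.Subset.antisymm (co_subset ?_ ?_) ?_
  · rintro _ ⟨c, hc, rfl⟩ _ ⟨d, hd, rfl⟩ s t hst
    refine ⟨(s +ᵥ c) ⊔ (t +ᵥ d), ?_, ?_⟩
    · have h1 : ∀ (s : Scalar) (c : Vec n → Scalar), Z.sup (s +ᵥ c) = s + Z.sup c :=
        fun s c => (add_finset_sup Z s c).symm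
      have h2 : Z.sup ((s +ᵥ c) ⊔ (t +ᵥ d)) = Z.sup (s +ᵥ c) ⊔ Z.sup (t +ᵥ d) := Finset.sup_sup
      rw [h2, h1, h1, hc, hd, add_zero, add_zero, hst]
    · rw [comb_sup, comb_vadd, comb_vadd]
      rfl
  · intro z hz
    refine ⟨fun g => if g = z then 0 else ⊥, le_antisymm (Finset.sup_le fun g _ => ?_) ?_,
      le_antisymm ?_ (Finset.sup_le fun g _ => ?_)⟩
    · split_ifs
      exacts [le_rfl, bot_le]
    · simpa using Finset.le_sup (f := fun g => if g = z then (0 : Scalar) else ⊥) hz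
    · simpa using vadd_le_comb hz (fun g => if g = z then 0 else ⊥)
    · dsimp only
      split_ifs with h
      · rw [h, zero_vadd]
      · rw [bot_vadd]
        exact bot_le
  · rintro _ ⟨c, hc, rfl⟩
    obtain ⟨z, hz, hcz⟩ := exists_mem_eq_zero_of_sup_eq_zero hc
    have hle : ∀ g ∈ Z, c g ≤ 0 := fun g hg => hc ▸ Finset.le_sup hg
    -- Adding `z`, which has the coefficient `0`, makes all partial sums convex combinations.
    have key : ∀ S ⊆ Z, z ⊔ comb S c ∈ co (Z : Set (Vec n)) := by
      intro S
      induction S using Finset.induction_on with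
      | empty => exact fun _ => by simpa [comb] using subset_co _ hz
      | insert g S _ ih =>
        intro hS
        rw [Finset.insert_subset_iff] at hS
        rw [comb, Finset.sup_insert, sup_left_comm, sup_comm]
        exact (isConvex_co _).sup_scale_mem (ih hS.2) (subset_co _ hS.1) (hle g hS.1)
    have h1 : z ≤ comb Z c := by
      have := vadd_le_comb hz c
      rwa [hcz, zero_vadd] at this
    have := key Z subset_rfl
    rwa [sup_eq_right.mpr h1] at this

theorem mem_minkowskiSum_co_cone {n : ℕ} {Z Y : Finset (Vec n)} {x : Vec n} :
    x ∈ minkowskiSum (co (Z : Set (Vec n))) (cone (Y : Set (Vec n))) ↔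
      ∃ c, Z.sup c = 0 ∧ ∃ y ∈ coneHull Y, x = comb Z c ⊔ y := by
  rw [co_coe, cone_coe]
  constructor
  · rintro ⟨_, ⟨c, hc, rfl⟩, y, hy, rfl⟩
    exact ⟨c, hc, y, hy, rfl⟩
  · rintro ⟨c, hc, y, hy, rfl⟩
    exact ⟨_, ⟨c, hc, rfl⟩, y, hy, rfl⟩

theorem isConvex_minkowskiSum {n : ℕ} {A B : Set (Vec n)} (hA : IsConvex A) (hB : IsCone B) :
    IsConvex (minkowskiSum A B) := by
  rintro _ ⟨a, ha, b, hb, rfl⟩ _ ⟨a', ha', b', hb', rfl⟩ s t hst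
  refine ⟨_, hA a ha a' ha' s t hst, _, hB.2 b hb b' hb' s t, ?_⟩
  simp only [scale_eq_vadd, vadd_sup]
  exact sup_sup_sup_comm _ _ _ _

theorem mem_minkowskiSum_of_left {n : ℕ} {A B : Set (Vec n)} (hB : IsCone B) {a : Vec n}
    (ha : a ∈ A) : a ∈ minkowskiSum A B := ⟨a, ha, ⊥, hB.1, sup_bot_eq a⟩

theorem isRepresentation_coe {n : ℕ} {C : Set (Vec n)} {Z Y : Finset (Vec n)} :
    IsRepresentation C Z Y ↔ C = minkowskiSum (co (Z : Set (Vec n))) (cone (Y : Set (Vec n))) := by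
  simp [IsRepresentation]

theorem IsRepresentation.exists_finset {n : ℕ} {C Z Y : Set (Vec n)}
    (h : IsRepresentation C Z Y) : ∃ Z' Y' : Finset (Vec n), (Z' : Set (Vec n)) = Z ∧
      (Y' : Set (Vec n)) = Y :=
  ⟨h.1.toFinset, h.2.1.toFinset, h.1.coe_toFinset, h.2.1.coe_toFinset⟩

/-! ### Homogenization -/

/-- The vector `x` with an additional entry `t`, indexed by `none`. -/
def homogenize {n : ℕ} (t : Scalar) (x : Vec n) : Option (Fin n) → Scalar :=
  fun o => o.elim t x

theorem homogenize_sup {n : ℕ} (s t : Scalar) (x y : Vec n) :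
    homogenize (s ⊔ t) (x ⊔ y) = homogenize s x ⊔ homogenize t y := by
  funext o
  cases o <;> rfl

theorem homogenize_add {n : ℕ} (s t : Scalar) (x : Vec n) :
    homogenize (s + t) (s +ᵥ x) = s +ᵥ homogenize t x := by
  funext o
  cases o <;> rfl

theorem homogenize_finset_sup {n : ℕ} {κ : Type*} (S : Finset κ) (t : κ → Scalar)
    (x : κ → Vec n) :
    homogenize (S.sup t) (S.sup x) = S.sup fun k => homogenize (t k) (x k) := by
  funext o
  rw [Finset.sup_apply]
  cases o
  · rfl
  · exact Finset.sup_apply ..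

theorem homogenize_self {n : ℕ} (w : Option (Fin n) → Scalar) :
    homogenize (w none) (w ∘ some) = w := by
  funext o
  cases o <;> rfl

theorem homogenize_injective {n : ℕ} {s t : Scalar} {x y : Vec n}
    (h : homogenize s x = homogenize t y) : s = t ∧ x = y :=
  ⟨congrFun h none, funext fun i => congrFun h (some i)⟩

theorem pairing_homogenize {n : ℕ} (c : Scalar) (a : Vec n) (t : Scalar) (x : Vec n) :
    pairing (homogenize c a) (homogenize t x) = dot a x ⊔ (c + t) := by
  refine le_antisymm (Finset.sup_le ?_) (sup_le (Finset.sup_le fun i _ => ?_) ?_)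
  · rintro (_ | i) _
    · exact le_sup_right
    · exact (le_pairing a x i).trans le_sup_left
  · exact le_pairing (homogenize c a) (homogenize t x) (some i)
  · exact le_pairing (homogenize c a) (homogenize t x) none

/-- A polyhedron is the section by the hyperplane where the additional entry is `0` of a
polyhedral cone. -/
theorem isPolyhedron_iff {n : ℕ} {C : Set (Vec n)} :
    IsPolyhedron C ↔ ∃ S : Finset ((Option (Fin n) → Scalar) × (Option (Fin n) → Scalar)),
      C = {x | ∀ p ∈ S, pairing p.1 (homogenize 0 x) ≤ pairing p.2 (homogenize 0 x)} := by
  classical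
  constructor
  · rintro ⟨S, hS, hH, rfl⟩
    choose! a b c d h using hH
    refine ⟨hS.toFinset.image fun H => (homogenize (c H) (a H), homogenize (d H) (b H)), ?_⟩
    ext x
    simp only [Set.mem_sInter, Set.mem_ofPred_eq, Finset.forall_mem_image,
      Set.Finite.mem_toFinset, pairing_homogenize, add_zero]
    refine forall₂_congr fun H hH => ?_
    conv_lhs => rw [h H hH]
    rfl
  · rintro ⟨S, rfl⟩
    refine ⟨(fun p : (Option (Fin n) → Scalar) × (Option (Fin n) → Scalar) =>
      {x | pairing p.1 (homogenize 0 x) ≤ pairing p.2 (homogenize 0 x)}) '' S,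
      S.finite_toSet.image _, ?_, ?_⟩
    · rintro _ ⟨p, _, rfl⟩
      refine ⟨p.1 ∘ some, p.2 ∘ some, p.1 none, p.2 none, ?_⟩
      dsimp only
      conv_lhs => rw [← homogenize_self p.1, ← homogenize_self p.2]
      simp only [pairing_homogenize, add_zero]
    · ext x
      simp

/-- The sum of a convex hull and a cone is a section of the cone generated by the points, with
the additional entry `0`, and the vectors, with the additional entry `⊥`. -/
theorem homogenize_mem_coneHull_iff {n : ℕ} [DecidableEq (Option (Fin n) → Scalar)]
    {Z Y : Finset (Vec n)} {x : Vec n} :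
    homogenize 0 x ∈ coneHull (Z.image (homogenize 0) ∪ Y.image (homogenize ⊥)) ↔
      x ∈ minkowskiSum (co (Z : Set (Vec n))) (cone (Y : Set (Vec n))) := by
  constructor
  · rintro ⟨c, hc⟩
    rw [comb, Finset.sup_union, Finset.sup_image, Finset.sup_image] at hc
    have hZ : (Z.sup ((fun g => c g +ᵥ g) ∘ homogenize 0)) =
        homogenize (Z.sup fun z => c (homogenize 0 z)) (comb Z fun z => c (homogenize 0 z)) := by
      rw [comb, homogenize_finset_sup]
      refine Finset.sup_congr rfl fun z _ => ?_
      rw [Function.comp_apply, ← homogenize_add, add_zero]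
    have hY : (Y.sup ((fun g => c g +ᵥ g) ∘ homogenize ⊥)) =
        homogenize ⊥ (comb Y fun z => c (homogenize ⊥ z)) := by
      have h0 : (⊥ : Scalar) = Y.sup fun _ => ⊥ := (Finset.sup_bot Y).symm
      conv_rhs => rw [comb, h0, homogenize_finset_sup]
      refine Finset.sup_congr rfl fun y _ => ?_
      rw [Function.comp_apply, ← homogenize_add, WithBot.add_bot, ← h0]
    rw [hZ, hY, ← homogenize_sup, sup_bot_eq] at hc
    obtain ⟨h1, h2⟩ := homogenize_injective hc
    exact mem_minkowskiSum_co_cone.mpr ⟨_, h1, _, ⟨_, rfl⟩, h2.symm⟩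
  · set K := coneHull (Z.image (homogenize 0) ∪ Y.image (homogenize ⊥)) with hK
    rintro ⟨u, hu, v, hv, rfl⟩
    have h1 : u ∈ {u : Vec n | homogenize 0 u ∈ K} := by
      refine co_subset ?_ ?_ hu
      · intro u hu v hv s t hst
        rw [Set.mem_ofPred_eq, ← hst, scale_eq_vadd, scale_eq_vadd, homogenize_sup]
        have h : ∀ (s : Scalar) (u : Vec n), homogenize 0 u ∈ K → homogenize s (s +ᵥ u) ∈ K := by
          intro s u hu
          have := vadd_mem_coneHull s hu
          rwa [← homogenize_add, add_zero] at this
        exact sup_mem_coneHull (h s u hu) (h t v hv)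
      · exact fun z hz => mem_coneHull_of_mem
          (Finset.mem_union_left _ (Finset.mem_image_of_mem _ hz))
    have h2 : v ∈ {v : Vec n | homogenize ⊥ v ∈ K} := by
      refine cone_subset ⟨?_, ?_⟩ ?_ hv
      · have : homogenize ⊥ (⊥ : Vec n) = ⊥ := by
          funext o
          cases o <;> rfl
        rw [Set.mem_ofPred_eq, this]
        exact bot_mem_coneHull _
      · intro u hu v hv s t
        have h : ∀ (s : Scalar) (u : Vec n), homogenize ⊥ u ∈ K → homogenize ⊥ (s +ᵥ u) ∈ K := by
          intro s u hu
          have := vadd_mem_coneHull s hu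
          rwa [← homogenize_add, WithBot.add_bot] at this
        rw [Set.mem_ofPred_eq, scale_eq_vadd, scale_eq_vadd, ← sup_idem (⊥ : Scalar),
          homogenize_sup]
        exact sup_mem_coneHull (h s u hu) (h t v hv)
      · exact fun y hy => mem_coneHull_of_mem
          (Finset.mem_union_right _ (Finset.mem_image_of_mem _ hy))
    have := sup_mem_coneHull h1 h2
    rwa [← homogenize_sup, sup_bot_eq] at this

/-- Up to scaling, the generators of a cone have the additional entry `0` or `⊥`. -/
theorem exists_coneHull_eq_homogenize {n : ℕ} [DecidableEq (Option (Fin n) → Scalar)]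
    (G : Finset (Option (Fin n) → Scalar)) :
    ∃ Z Y : Finset (Vec n),
      coneHull (Z.image (homogenize 0) ∪ Y.image (homogenize ⊥)) = coneHull G := by
  classical
  -- Generators with a finite additional entry are divided by it.
  have hex : ∀ g : Option (Fin n) → Scalar, ∃ z : Vec n, g none ≠ ⊥ →
      ∃ r : ℝ, homogenize 0 z = ((-r : ℝ) : Scalar) +ᵥ g ∧ g = (r : Scalar) +ᵥ homogenize 0 z := by
    intro g
    by_cases hg : g none = ⊥
    · exact ⟨⊥, fun h => absurd hg h⟩
    · obtain ⟨r, hr⟩ := WithBot.ne_bot_iff_exists.mp hg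
      have h1 : homogenize 0 (((-r : ℝ) : Scalar) +ᵥ (g ∘ some)) = ((-r : ℝ) : Scalar) +ᵥ g := by
        conv_rhs => rw [← homogenize_self g, ← homogenize_add, ← hr, ← WithBot.coe_add,
          neg_add_cancel, WithBot.coe_zero]
      exact ⟨_, fun _ => ⟨r, h1, by rw [h1, coe_vadd_neg_coe_vadd]⟩⟩
  choose z hz using hex
  have hself : ∀ g : Option (Fin n) → Scalar, g none = ⊥ → homogenize ⊥ (g ∘ some) = g :=
    fun g hg => by rw [← hg, homogenize_self]
  refine ⟨(G.filter fun g => g none ≠ ⊥).image z, (G.filter fun g => g none = ⊥).image (· ∘ some),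
    Set.Subset.antisymm (coneHull_subset_coneHull ?_) (coneHull_subset_coneHull ?_)⟩
  · intro w hw
    simp only [Finset.mem_union, Finset.mem_image, Finset.mem_filter] at hw
    rcases hw with ⟨_, ⟨g, ⟨hg, hb⟩, rfl⟩, rfl⟩ | ⟨_, ⟨g, ⟨hg, hb⟩, rfl⟩, rfl⟩
    · obtain ⟨r, h1, -⟩ := hz g hb
      rw [h1]
      exact vadd_mem_coneHull _ (mem_coneHull_of_mem hg)
    · rw [hself g hb]
      exact mem_coneHull_of_mem hg
  · intro g hg
    by_cases hb : g none = ⊥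
    · refine mem_coneHull_of_mem (Finset.mem_union_right _ ?_)
      exact Finset.mem_image.mpr
        ⟨_, Finset.mem_image_of_mem _ (Finset.mem_filter.mpr ⟨hg, hb⟩), hself g hb⟩
    · obtain ⟨r, -, h2⟩ := hz g hb
      rw [h2]
      exact vadd_mem_coneHull _ (mem_coneHull_of_mem (Finset.mem_union_left _
        (Finset.mem_image_of_mem _ (Finset.mem_image_of_mem _ (Finset.mem_filter.mpr ⟨hg, hb⟩)))))

/-- The max-plus Minkowski–Weyl theorem. -/
theorem isPolyhedron_iff_exists_isRepresentation {n : ℕ} {C : Set (Vec n)} :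
    IsPolyhedron C ↔ ∃ Z Y, IsRepresentation C Z Y := by
  classical
  rw [isPolyhedron_iff]
  constructor
  · rintro ⟨S, rfl⟩
    obtain ⟨G, hG⟩ := exists_coneHull_eq_iInter_halfSpace S
    obtain ⟨Z, Y, h⟩ := exists_coneHull_eq_homogenize G
    refine ⟨Z, Y, isRepresentation_coe.mpr ?_⟩
    ext x
    rw [← homogenize_mem_coneHull_iff, h, hG]
    rfl
  · rintro ⟨Z, Y, h⟩
    obtain ⟨Z, Y, rfl, rfl⟩ := h.exists_finset
    obtain ⟨S, hS⟩ := exists_iInter_halfSpace_eq_coneHull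
      (Z.image (homogenize 0) ∪ Y.image (homogenize ⊥))
    refine ⟨S, ?_⟩
    ext x
    rw [isRepresentation_coe.mp h, ← homogenize_mem_coneHull_iff, hS]
    rfl

/-! ### The recession cone -/

theorem eventually_lt_coe_add (a : Scalar) {b : Scalar} (hb : b ≠ ⊥) :
    ∀ᶠ r : ℝ in Filter.atTop, a < (r : Scalar) + b := by
  obtain ⟨β, rfl⟩ := WithBot.ne_bot_iff_exists.mp hb
  rcases eq_or_ne a ⊥ with rfl | ha
  · exact Filter.Eventually.of_forall fun r => WithBot.bot_lt_coe (r + β)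
  · obtain ⟨α, rfl⟩ := WithBot.ne_bot_iff_exists.mp ha
    filter_upwards [Filter.eventually_gt_atTop (α - β)] with r hr
    norm_cast
    linarith

/-- If all the points `x ⊔ (r + u)` lie in the set, then for large `r` their entries in the support
of `u` come from the generators of the cone, which forces `u` to be generated by them. -/
theorem cone_eq_recessionCone {n : ℕ} {C Z Y : Set (Vec n)} (hC : C.Nonempty)
    (h : IsRepresentation C Z Y) : cone Y = recessionCone C := by
  obtain ⟨Z, Y, rfl, rfl⟩ := h.exists_finset
  obtain rfl := isRepresentation_coe.mp h
  refine Set.Subset.antisymm (fun u hu => ?_) ?_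
  · obtain ⟨_, a, ha, b, hb, rfl⟩ := hC
    refine ⟨_, ⟨a, ha, b, hb, rfl⟩, fun t => ⟨a, ha, b ⊔ scale t u, ?_, ?_⟩⟩
    · exact (isCone_cone _).sup_mem hb ((isCone_cone _).scale_mem hu t)
    · exact (sup_assoc _ _ _).symm
  · rintro u ⟨x, -, hu⟩
    rw [cone_coe, mem_coneHull_iff]
    intro i hi
    by_contra! hn
    -- For a large scalar `r`, a generator attaining the entry `i` of `x ⊔ (r + u)` would have to
    -- be one whose multiples below `u` attain the entry `i` of `u`.
    have ev1 : ∀ᶠ r : ℝ in Filter.atTop, ∀ z ∈ Z, z i < (r : Scalar) + u i :=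
      (Filter.eventually_all_finset Z).mpr fun z _ => eventually_lt_coe_add (z i) hi
    have ev2 : ∀ᶠ r : ℝ in Filter.atTop, ∀ y ∈ Y, ∀ t : Scalar, t + y i = u i →
        ∃ k, x k < (r : Scalar) + (t + y k) ∧ u k < t + y k := by
      refine (Filter.eventually_all_finset Y).mpr fun y hy => ?_
      by_cases ht : ∃ t : Scalar, t + y i = u i
      · obtain ⟨t, ht⟩ := ht
        have h1 := hn y hy t ht
        simp only [Pi.le_def, not_forall, not_le, Pi.vadd_apply, vadd_eq_add] at h1
        obtain ⟨k, hk⟩ := h1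
        filter_upwards [eventually_lt_coe_add (x k) (bot_le.trans_lt hk).ne'] with r hr t' ht'
        have : t' = t := by
          have hy0 : y i ≠ ⊥ := fun h0 => hi (by rw [← ht, h0, WithBot.add_bot])
          obtain ⟨η, hη⟩ := WithBot.ne_bot_iff_exists.mp hy0
          have h2 := congrArg (((-η : ℝ) : Scalar) + ·) (ht'.trans ht.symm)
          simpa only [← hη, add_comm _ (η : Scalar), neg_coe_add_coe_add] using h2
        exact ⟨k, this ▸ hr, this ▸ hk⟩
      · exact Filter.Eventually.of_forall fun r t h => absurd ⟨t, h⟩ ht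
    have ev3 := eventually_lt_coe_add (x i) hi
    obtain ⟨r, hr1, hr2, hr3⟩ := (ev1.and (ev2.and ev3)).exists
    obtain ⟨c, hc, y, hy, hxy⟩ := mem_minkowskiSum_co_cone.mp (hu r)
    have hxi : (r : Scalar) + u i = comb Z c i ⊔ y i := by
      have := congrFun hxy i
      rwa [Pi.sup_apply, sup_eq_right.mpr (show x i ≤ scale r u i from hr3.le)] at this
    have hru : ⊥ < (r : Scalar) + u i := bot_le.trans_lt hr3
    have hZ : comb Z c i < (r : Scalar) + u i := by
      rw [comb_apply, Finset.sup_lt_iff hru]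
      intro z hz
      refine lt_of_le_of_lt ?_ (hr1 z hz)
      have := add_le_add_left (hc ▸ Finset.le_sup hz : c z ≤ 0) (z i)
      rwa [zero_add] at this
    have hyi : y i = (r : Scalar) + u i := by
      rcases max_choice (comb Z c i) (y i) with h1 | h1
      · exact absurd (hxi.trans h1) hZ.ne'
      · exact (hxi.trans h1).symm
    obtain ⟨g, hg, t, ht, hle⟩ := mem_coneHull_iff.mp hy i (by rw [hyi]; exact hru.ne')
    obtain ⟨k, hk1, hk2⟩ := hr2 g hg (((-r : ℝ) : Scalar) + t) (by
      rw [add_assoc, ht, hyi, neg_coe_add_coe_add])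
    rw [add_assoc, coe_add_neg_coe_add] at hk1
    have hk3 : t + g k ≤ x k ⊔ ((r : Scalar) + u k) := by
      have h1 : y k ≤ (x ⊔ scale r u) k := by
        rw [hxy]
        exact le_sup_right
      exact (hle k).trans h1
    rcases le_sup_iff.mp hk3 with h1 | h1
    · exact absurd h1 hk1.not_ge
    · have := add_le_add_right h1 ((-r : ℝ) : Scalar)
      rw [neg_coe_add_coe_add, ← add_assoc] at this
      exact absurd this hk2.not_ge

/-! ### Minimal generating sets and extreme rays -/

theorem IsExtremeVector.exists_eq_of_eq_finset_sup {n : ℕ} {V : Set (Vec n)} {v : Vec n}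
    (hv : IsExtremeVector V v) (hV : IsCone V) {κ : Type*} {S : Finset κ} {f : κ → Vec n}
    (hf : ∀ k ∈ S, f k ∈ V) (h : v = S.sup f) : ∃ k ∈ S, v = f k := by
  classical
  induction S using Finset.induction_on with
  | empty => exact absurd (by simpa using h) hv.2.1
  | insert k S _ ih =>
    rw [Finset.forall_mem_insert] at hf
    rw [Finset.sup_insert] at h
    have hS : S.sup f ∈ V := Finset.sup_mem V hV.1 (fun _ ha _ hb => hV.sup_mem ha hb) S f hf.2
    rcases hv.2.2 _ hf.1 _ hS h with h1 | h1
    · exact ⟨k, Finset.mem_insert_self k S, h1⟩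
    · obtain ⟨j, hj, h2⟩ := ih hf.2 h1
      exact ⟨j, Finset.mem_insert_of_mem hj, h2⟩

/-- Every finite generating set contains a multiple of each extreme vector. -/
theorem IsExtremeVector.exists_eq_scale {n : ℕ} {Y : Finset (Vec n)} {v : Vec n}
    (hv : IsExtremeVector (cone (Y : Set (Vec n))) v) : ∃ y ∈ Y, ∃ t : Scalar, v = scale t y := by
  have h := hv.1
  rw [cone_coe] at h
  obtain ⟨c, hc⟩ := h
  obtain ⟨y, hy, h⟩ := hv.exists_eq_of_eq_finset_sup (isCone_cone _)
    (fun y hy => (isCone_cone _).scale_mem (subset_cone _ hy) (c y)) hc.symm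
  exact ⟨y, hy, c y, h⟩

theorem exists_coe_of_scale_ne_bot {n : ℕ} {t : Scalar} {v : Vec n} (h : scale t v ≠ ⊥) :
    ∃ r : ℝ, t = r := by
  obtain ⟨r, hr⟩ := WithBot.ne_bot_iff_exists.mp fun h0 : t = ⊥ => h (h0 ▸ bot_vadd v)
  exact ⟨r, hr.symm⟩

theorem range_scale_coe {n : ℕ} (r : ℝ) (v : Vec n) :
    {x | ∃ t : Scalar, x = scale t (scale r v)} = {x | ∃ t : Scalar, x = scale t v} := by
  ext x
  constructor
  · rintro ⟨t, rfl⟩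
    exact ⟨t + r, (add_vadd t (r : Scalar) v).symm⟩
  · rintro ⟨t, rfl⟩
    refine ⟨t + ((-r : ℝ) : Scalar), ?_⟩
    simp only [scale_eq_vadd]
    rw [add_vadd, neg_coe_vadd_coe_vadd]

theorem IsExtremeVector.scale_coe {n : ℕ} {V : Set (Vec n)} (hV : IsCone V) {v : Vec n}
    (hv : IsExtremeVector V v) (r : ℝ) : IsExtremeVector V (scale r v) := by
  have hback : ∀ {u : Vec n}, v = scale ((-r : ℝ) : Scalar) u → scale r v = u := by
    rintro u rfl
    exact coe_vadd_neg_coe_vadd r u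
  refine ⟨hV.scale_mem hv.1 _, fun h0 => hv.2.1 ?_, fun u hu w hw h => ?_⟩
  · rw [← neg_coe_vadd_coe_vadd r v, ← scale_eq_vadd (r : Scalar), h0, vadd_bot]
  · have h1 : v = scale ((-r : ℝ) : Scalar) u ⊔ scale ((-r : ℝ) : Scalar) w := by
      rw [scale_eq_vadd, scale_eq_vadd, ← vadd_sup, ← h, scale_eq_vadd, neg_coe_vadd_coe_vadd]
    exact (hv.2.2 _ (hV.scale_mem hu _) _ (hV.scale_mem hw _) h1).imp hback hback

/-- Every nonzero vector of an extreme ray is extreme and spans the ray. -/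
theorem IsExtremeRay.isExtremeVector_of_mem {n : ℕ} {V R : Set (Vec n)} (hV : IsCone V)
    (hR : IsExtremeRay V R) {y : Vec n} (hy : y ∈ R) (h0 : y ≠ ⊥) :
    IsExtremeVector V y ∧ R = {x | ∃ t : Scalar, x = scale t y} := by
  obtain ⟨v, hv, rfl⟩ := hR
  obtain ⟨t, rfl⟩ := hy
  obtain ⟨r, rfl⟩ := exists_coe_of_scale_ne_bot h0
  exact ⟨hv.scale_coe hV r, (range_scale_coe r v).symm⟩

theorem IsExtremeVector.isExtremeRay {n : ℕ} {V : Set (Vec n)} {v : Vec n}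
    (hv : IsExtremeVector V v) : IsExtremeRay V {x | ∃ t : Scalar, x = scale t v} := ⟨v, hv, rfl⟩

theorem mem_range_scale_self {n : ℕ} (v : Vec n) : v ∈ {x | ∃ t : Scalar, x = scale t v} :=
  ⟨0, (zero_vadd Scalar v).symm⟩

theorem exists_minimal_subset {α : Type*} {P : Set α → Prop} {X : Set α} (hX : X.Finite)
    (h : P X) : ∃ M ⊆ X, Minimal P M := by
  obtain ⟨M, hMX, hM⟩ := (hX.finite_subsets.subset
    (Set.sep_subset {A | A ⊆ X} P)).exists_le_minimal (a := X) ⟨Set.Subset.refl X, h⟩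
  exact ⟨M, hMX, hM.prop.2, fun A hA hAM => hM.le_of_le ⟨hAM.trans hMX, hA⟩ hAM⟩

/-- A minimal finite generating set is a selection of vectors in the extreme rays. -/
theorem isExtremeRaySelection_of_minimal {n : ℕ} {V Y : Set (Vec n)}
    (h : Minimal (fun Y' => Y'.Finite ∧ cone Y' = V) Y) : IsExtremeRaySelection V Y := by
  classical
  obtain ⟨hfin, rfl⟩ := h.prop
  lift Y to Finset (Vec n) using hfin
  -- No element of `Y` is generated by the other ones.
  have hmin : ∀ y ∈ Y, y ∉ cone ((Y.erase y : Finset (Vec n)) : Set (Vec n)) := by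
    intro y hy hmem
    have hsub : (Y.erase y : Set (Vec n)) ⊆ Y := by
      exact_mod_cast Finset.erase_subset y Y
    have h1 : cone ((Y.erase y : Finset (Vec n)) : Set (Vec n)) = cone (Y : Set (Vec n)) := by
      refine Set.Subset.antisymm (cone_subset (isCone_cone _) (hsub.trans (subset_cone _)))
        (cone_subset (isCone_cone _) fun x hx => ?_)
      rcases eq_or_ne x y with rfl | hxy
      · exact hmem
      · exact subset_cone _ (Finset.mem_coe.mpr (Finset.mem_erase.mpr ⟨hxy, hx⟩))
    have h2 := h.le_of_le ⟨Finset.finite_toSet _, h1⟩ hsub hy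
    exact Finset.notMem_erase y Y h2
  have hne : ∀ y ∈ Y, y ≠ ⊥ := fun y hy h0 => hmin y hy (h0 ▸ (isCone_cone _).1)
  have hext : ∀ y ∈ Y, IsExtremeVector (cone (Y : Set (Vec n))) y := by
    refine fun y hy => ⟨subset_cone _ hy, hne y hy, fun u hu w hw huw => ?_⟩
    rw [cone_coe] at hu hw
    obtain ⟨c, rfl⟩ := hu
    obtain ⟨d, rfl⟩ := hw
    have h1 : y = comb Y (c ⊔ d) ⊔ ⊥ := by rw [comb_sup, ← huw, sup_bot_eq]
    rcases lt_or_ge ((c ⊔ d) y) 0 with h2 | h2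
    · refine absurd ?_ (hmin y hy)
      rw [cone_coe]
      exact ⟨_, ((eq_comb_erase_sup hy h2 h1).trans (sup_bot_eq _)).symm⟩
    · have h3 : ∀ c : Vec n → Scalar, 0 ≤ c y → y ≤ comb Y c := fun c hc =>
        (zero_vadd Scalar y).symm.le.trans ((vadd_le_vadd hc y).trans (vadd_le_comb hy c))
      rcases le_sup_iff.mp h2 with h4 | h4
      · exact Or.inl ((h3 c h4).antisymm (le_sup_left.trans huw.ge))
      · exact Or.inr ((h3 d h4).antisymm (le_sup_right.trans huw.ge))
  refine ⟨fun y hy => ⟨hne y hy, _, (hext y hy).isExtremeRay, mem_range_scale_self y⟩, ?_⟩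
  rintro _ ⟨v, hv, rfl⟩
  obtain ⟨y, hy, t, hvt⟩ := hv.exists_eq_scale
  obtain ⟨r, rfl⟩ := exists_coe_of_scale_ne_bot (hvt ▸ hv.2.1)
  refine ⟨y, ⟨hy, ?_⟩, ?_⟩
  · rw [hvt, range_scale_coe]
    exact mem_range_scale_self y
  · rintro y' ⟨hy', hyR⟩
    rw [hvt, range_scale_coe] at hyR
    obtain ⟨s, hs⟩ := hyR
    by_contra hne'
    refine hmin y' hy' ?_
    have h1 : y ∈ cone ((Y.erase y' : Finset (Vec n)) : Set (Vec n)) :=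
      subset_cone _ (Finset.mem_coe.mpr (Finset.mem_erase.mpr ⟨Ne.symm hne', hy⟩))
    have h2 := (isCone_cone _).scale_mem h1 s
    rwa [← hs] at h2

/-- In a finitely generated cone, the selections of vectors in the extreme rays are the minimal
finite generating sets. -/
theorem minimal_generating_iff {n : ℕ} {V Y₀ Y : Set (Vec n)} (hfin : Y₀.Finite)
    (hV : cone Y₀ = V) :
    Minimal (fun Y' => Y'.Finite ∧ cone Y' = V) Y ↔ IsExtremeRaySelection V Y := by
  refine ⟨isExtremeRaySelection_of_minimal, fun hY => ?_⟩
  obtain ⟨Y₁, -, hY₁⟩ := exists_minimal_subset (P := fun Y' => Y'.Finite ∧ cone Y' = V) hfin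
    ⟨hfin, hV⟩
  have hsel := isExtremeRaySelection_of_minimal hY₁
  have hcone : IsCone V := hV ▸ isCone_cone _
  have hext : ∀ y ∈ Y, IsExtremeVector V y := by
    intro y hy
    obtain ⟨h0, R, hR, hyR⟩ := hY.1 y hy
    exact (hR.isExtremeVector_of_mem hcone hyR h0).1
  have hYfin : Y.Finite := by
    refine (hY₁.prop.1.biUnion (t := fun z => {y | y ∈ Y ∧ y ∈ {x | ∃ t : Scalar, x = scale t z}})
      fun z hz => ?_).subset fun y hy => ?_
    · obtain ⟨h0, R, hR, hzR⟩ := hsel.1 z hz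
      obtain ⟨hzv, -⟩ := hR.isExtremeVector_of_mem hcone hzR h0
      have hu := hY.2 _ hzv.isExtremeRay
      exact Set.Subsingleton.finite fun a ha b hb => hu.unique ha hb
    · obtain ⟨z, ⟨hz, hzR⟩, -⟩ := hsel.2 _ (hext y hy).isExtremeRay
      obtain ⟨-, hR⟩ := (hext y hy).isExtremeRay.isExtremeVector_of_mem hcone hzR (hsel.1 z hz).1
      exact Set.mem_biUnion hz ⟨hy, hR ▸ mem_range_scale_self y⟩
  have hYcone : cone Y = V := by
    refine Set.Subset.antisymm (cone_subset hcone fun y hy => (hext y hy).1) ?_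
    rw [← hY₁.prop.2]
    refine cone_subset (isCone_cone _) fun z hz => ?_
    obtain ⟨h0, R, hR, hzR⟩ := hsel.1 z hz
    obtain ⟨y, ⟨hy, hyR⟩, -⟩ := hY.2 R hR
    obtain ⟨-, hRy⟩ := hR.isExtremeVector_of_mem hcone hyR (hY.1 y hy).1
    rw [hRy] at hzR
    obtain ⟨t, rfl⟩ := hzR
    exact (isCone_cone _).scale_mem (subset_cone _ hy) t
  refine ⟨⟨hYfin, hYcone⟩, fun Y' hY' hsub y hy => ?_⟩
  obtain ⟨hfin', hcone'⟩ := hY'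
  lift Y' to Finset (Vec n) using hfin'
  have hv := hext y hy
  have hv' := hv
  rw [← hcone'] at hv'
  obtain ⟨y', hy', t, ht⟩ := hv'.exists_eq_scale
  obtain ⟨r, rfl⟩ := exists_coe_of_scale_ne_bot (ht ▸ hv.2.1)
  have hmem : y' ∈ {x | ∃ t : Scalar, x = scale t y} := by
    rw [ht, range_scale_coe]
    exact mem_range_scale_self y'
  rw [(hY.2 _ hv.isExtremeRay).unique ⟨hy, mem_range_scale_self y⟩ ⟨hsub hy', hmem⟩]
  exact hy'

theorem isRepresentation_empty_iff {n : ℕ} {Z Y : Set (Vec n)} :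
    IsRepresentation ∅ Z Y ↔ Z = ∅ ∧ Y.Finite := by
  constructor
  · rintro ⟨-, hY, h⟩
    refine ⟨Set.eq_empty_of_forall_notMem fun z hz => ?_, hY⟩
    have := mem_minkowskiSum_of_left (isCone_cone Y) (subset_co Z hz)
    rwa [← h] at this
  · rintro ⟨rfl, hY⟩
    exact ⟨Set.finite_empty, hY, by simp [co_empty, minkowskiSum]⟩

theorem minimal_vectors_iff {n : ℕ} {C : Set (Vec n)} (hC : ∃ Z Y, IsRepresentation C Z Y)
    {Y : Set (Vec n)} :
    Minimal (fun Y' => ∃ Z, IsRepresentation C Z Y') Y ↔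
      IsExtremeRaySelection (recessionCone C) Y := by
  obtain ⟨Z₀, Y₀, h₀⟩ := hC
  rcases C.eq_empty_or_nonempty with rfl | hne
  · -- The recession cone of the empty set is empty, so it has no extreme rays.
    have hrec : recessionCone (∅ : Set (Vec n)) = ∅ :=
      Set.eq_empty_of_forall_notMem fun _ ⟨_, hx, _⟩ => hx
    have hray : ∀ R, ¬ IsExtremeRay (∅ : Set (Vec n)) R := fun R ⟨_, hv, _⟩ => hv.1
    rw [hrec]
    constructor
    · intro h
      have h1 : Y ⊆ ∅ := h.le_of_le ⟨∅, isRepresentation_empty_iff.mpr ⟨rfl, Set.finite_empty⟩⟩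
        (Set.empty_subset Y)
      exact ⟨fun y hy => (h1 hy).elim, fun R hR => (hray R hR).elim⟩
    · rintro ⟨h, -⟩
      obtain rfl : Y = ∅ := Set.eq_empty_of_forall_notMem fun y hy =>
        let ⟨_, R, hR, _⟩ := h y hy
        hray R hR
      exact ⟨⟨∅, isRepresentation_empty_iff.mpr ⟨rfl, Set.finite_empty⟩⟩,
        fun _ _ _ => Set.empty_subset _⟩
  · have hrec := cone_eq_recessionCone hne h₀
    rw [← minimal_generating_iff h₀.2.1 hrec]
    have : (fun Y' => ∃ Z, IsRepresentation C Z Y') =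
        fun Y' => Y'.Finite ∧ cone Y' = recessionCone C := by
      funext Y'
      refine propext ⟨fun ⟨Z, h⟩ => ⟨h.2.1, cone_eq_recessionCone hne h⟩, fun ⟨h1, h2⟩ =>
        ⟨Z₀, h₀.1, h1, ?_⟩⟩
      rw [h2, ← hrec]
      exact h₀.2.2
    rw [this]

/-! ### Extreme points -/

/-- An extreme point is a convex combination of points plus a vector of the cone. Extremality
makes it either one of these points, or the sum of one point and the vector, which is then
absorbed by the point. -/
theorem extremePoints_subset_of_isRepresentation {n : ℕ} {C Z Y : Set (Vec n)}
    (h : IsRepresentation C Z Y) : extremePoints C ⊆ Z := by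
  classical
  obtain ⟨Z, Y, rfl, rfl⟩ := h.exists_finset
  obtain rfl := isRepresentation_coe.mp h
  set C := minkowskiSum (co (Z : Set (Vec n))) (cone (Y : Set (Vec n))) with hC
  rintro v ⟨hvC, hv⟩
  obtain ⟨c, hc, y, hy, hvy⟩ := mem_minkowskiSum_co_cone.mp hvC
  rw [← cone_coe] at hy
  obtain ⟨z, hz, hcz⟩ := exists_mem_eq_zero_of_sup_eq_zero hc
  have hle : ∀ g ∈ Z, c g ≤ 0 := fun g hg => hc ▸ Finset.le_sup hg
  have hZC : ∀ g ∈ Z, g ∈ C := fun g hg =>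
    mem_minkowskiSum_of_left (isCone_cone _) (subset_co _ hg)
  have hconv : IsConvex C := isConvex_minkowskiSum (isConvex_co _) (isCone_cone _)
  have hzC : ∀ t : Scalar, z ⊔ (t +ᵥ y) ∈ C := fun t =>
    ⟨z, subset_co _ hz, _, (isCone_cone _).scale_mem hy t, rfl⟩
  have hv' : ∀ u ∈ C, ∀ w ∈ C, ∀ t ≤ (0 : Scalar), v = u ⊔ (t +ᵥ w) → v = u ∨ v = w :=
    fun u hu w hw t ht h => hv u hu w hw 0 t (sup_eq_left.mpr ht) (by
      rw [scale_eq_vadd, scale_eq_vadd, zero_vadd]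
      exact h)
  have hzy : z ⊔ y ∈ C := by
    have := hzC 0
    rwa [zero_vadd] at this
  -- The generators other than `z` are split off one by one.
  have key : ∀ S ⊆ Z, (z ⊔ y) ⊔ comb S c ∈ C ∧ (v = (z ⊔ y) ⊔ comb S c → v = z ⊔ y ∨ v ∈ Z) := by
    intro S
    induction S using Finset.induction_on with
    | empty => exact fun _ => by simpa [comb] using ⟨hzy, fun h => Or.inl h⟩
    | insert g S _ ih =>
      intro hS
      rw [Finset.insert_subset_iff] at hS
      obtain ⟨h1, h2⟩ := ih hS.2
      have h3 : (z ⊔ y) ⊔ comb (insert g S) c = ((z ⊔ y) ⊔ comb S c) ⊔ (c g +ᵥ g) := by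
        rw [comb, Finset.sup_insert, sup_left_comm, sup_comm]
        rfl
      rw [h3]
      refine ⟨hconv.sup_scale_mem h1 (hZC g hS.1) (hle g hS.1), fun h => ?_⟩
      rcases hv' _ h1 _ (hZC g hS.1) _ (hle g hS.1) h with h4 | h4
      · exact h2 h4
      · exact Or.inr (h4 ▸ hS.1)
  have hzle : z ≤ comb Z c := by
    have := vadd_le_comb hz c
    rwa [hcz, zero_vadd] at this
  have hvz : v = (z ⊔ y) ⊔ comb Z c := by
    rw [sup_right_comm, sup_eq_right.mpr hzle]
    exact hvy
  rcases (key Z subset_rfl).2 hvz with h1 | h1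
  · -- The point `z ⊔ y` is a convex combination of `z` and `z ⊔ (1 + y)`, so it is one of them;
    -- since `1 > 0`, it is `z` in both cases.
    have h2 : v = z ⊔ (((-1 : ℝ) : Scalar) +ᵥ (z ⊔ (((1 : ℝ) : Scalar) +ᵥ y))) := by
      have h4 : ((-1 : ℝ) : Scalar) +ᵥ z ≤ z := by
        have := vadd_le_vadd (show ((-1 : ℝ) : Scalar) ≤ 0 by norm_cast) z
        rwa [zero_vadd] at this
      rw [vadd_sup, neg_coe_vadd_coe_vadd, ← sup_assoc, sup_eq_left.mpr h4, h1]
    have h3 : v = z := by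
      rcases hv' z (hZC z hz) _ (hzC _) _ (by norm_cast) h2 with h4 | h4
      · exact h4
      · rw [h1]
        refine sup_eq_left.mpr fun i => ?_
        have h5 : y i ≤ z i ⊔ (((1 : ℝ) : Scalar) + y i) := by
          have h6 : y ≤ z ⊔ (((1 : ℝ) : Scalar) +ᵥ y) := by
            rw [← h4, h1]
            exact le_sup_right
          exact h6 i
        have h7 : z i ⊔ (((1 : ℝ) : Scalar) + y i) = z i ⊔ y i :=
          (congrFun (h4.symm.trans h1) i)
        rcases eq_or_ne (y i) ⊥ with hb | hb
        · rw [hb]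
          exact bot_le
        · have h8 : y i < ((1 : ℝ) : Scalar) + y i := by
            have := WithBot.add_lt_add_right hb (show (0 : Scalar) < ((1 : ℝ) : Scalar) by norm_cast)
            rwa [zero_add] at this
          by_contra hlt
          have h9 : ((1 : ℝ) : Scalar) + y i ≤ z i ⊔ y i := h7 ▸ le_sup_right
          rw [sup_eq_right.mpr (not_le.mp hlt).le] at h9
          exact h9.not_gt h8
    exact h3 ▸ hz
  · exact h1

/-- The elements of a minimal set of points are extreme, since an element that is not extreme is
generated by the other ones and by the vectors. -/
theorem subset_extremePoints_of_minimal {n : ℕ} {C Z : Set (Vec n)}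
    (h : Minimal (fun Z' => ∃ Y, IsRepresentation C Z' Y) Z) : Z ⊆ extremePoints C := by
  classical
  obtain ⟨Y, hrep⟩ := h.prop
  obtain ⟨Z, Y, rfl, rfl⟩ := hrep.exists_finset
  have hC := isRepresentation_coe.mp hrep
  have hmin : ∀ z ∈ Z, z ∉ minkowskiSum (co ((Z.erase z : Finset (Vec n)) : Set (Vec n)))
      (cone (Y : Set (Vec n))) := by
    intro z hz hmem
    have hsub : ((Z.erase z : Finset (Vec n)) : Set (Vec n)) ⊆ Z := by
      exact_mod_cast Finset.erase_subset z Z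
    have h1 : C = minkowskiSum (co ((Z.erase z : Finset (Vec n)) : Set (Vec n)))
        (cone (Y : Set (Vec n))) := by
      rw [hC]
      refine Set.Subset.antisymm ?_ (Set.image2_subset
        (co_subset (isConvex_co _) (hsub.trans (subset_co _))) subset_rfl)
      have h2 : co (Z : Set (Vec n)) ⊆ minkowskiSum
          (co ((Z.erase z : Finset (Vec n)) : Set (Vec n))) (cone (Y : Set (Vec n))) := by
        refine co_subset (isConvex_minkowskiSum (isConvex_co _) (isCone_cone _)) fun x hx => ?_
        rcases eq_or_ne x z with rfl | hxz
        · exact hmem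
        · exact mem_minkowskiSum_of_left (isCone_cone _)
            (subset_co _ (Finset.mem_coe.mpr (Finset.mem_erase.mpr ⟨hxz, hx⟩)))
      rintro _ ⟨u, hu, v, hv, rfl⟩
      obtain ⟨a, ha, b, hb, rfl⟩ := h2 hu
      exact ⟨a, ha, b ⊔ v, (isCone_cone _).sup_mem hb hv, (sup_assoc a b v).symm⟩
    exact Finset.notMem_erase z Z (h.le_of_le ⟨_, isRepresentation_coe.mpr h1⟩ hsub hz)
  intro z hz
  refine ⟨hC ▸ mem_minkowskiSum_of_left (isCone_cone _) (subset_co _ hz),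
    fun u hu w hw s t hst huw => ?_⟩
  rw [hC] at hu hw
  obtain ⟨c, hc, y, hy, rfl⟩ := mem_minkowskiSum_co_cone.mp hu
  obtain ⟨d, hd, y', hy', rfl⟩ := mem_minkowskiSum_co_cone.mp hw
  set e : Vec n → Scalar := (s +ᵥ c) ⊔ (t +ᵥ d) with he
  have hcle : c z ≤ 0 := hc ▸ Finset.le_sup hz
  have hdle : d z ≤ 0 := hd ▸ Finset.le_sup hz
  have hz1 : z = comb Z e ⊔ ((s +ᵥ y) ⊔ (t +ᵥ y')) := by
    rw [huw, he, comb_sup, comb_vadd, comb_vadd, scale_eq_vadd, scale_eq_vadd, vadd_sup, vadd_sup]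
    exact sup_sup_sup_comm _ _ _ _
  rcases lt_or_ge (e z) 0 with h1 | h1
  · refine absurd ?_ (hmin z hz)
    have he0 : Z.sup e = 0 := by
      have h2 : ∀ (s : Scalar) (c : Vec n → Scalar), Z.sup (s +ᵥ c) = s + Z.sup c :=
        fun s c => (add_finset_sup Z s c).symm
      have h3 : Z.sup e = Z.sup (s +ᵥ c) ⊔ Z.sup (t +ᵥ d) := Finset.sup_sup
      rw [h3, h2, h2, hc, hd, add_zero, add_zero, hst]
    refine mem_minkowskiSum_co_cone.mpr ⟨e, ?_, _,
      sup_mem_coneHull (vadd_mem_coneHull s hy) (vadd_mem_coneHull t hy'),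
      eq_comb_erase_sup hz h1 hz1⟩
    rw [← Finset.insert_erase hz, Finset.sup_insert] at he0
    rcases max_choice (e z) ((Z.erase z).sup e) with h4 | h4
    · exact absurd (he0.symm.trans h4) h1.ne'
    · exact h4.symm.trans he0
  · -- One of the two points has the coefficient `0` and lies above `z`.
    have hs : s ≤ 0 := hst ▸ le_sup_left
    have ht : t ≤ 0 := hst ▸ le_sup_right
    have h2 : ∀ (s : Scalar) (c : Vec n → Scalar) (y : Vec n), s ≤ 0 → c z ≤ 0 → 0 ≤ s + c z →
        scale s (comb Z c ⊔ y) ≤ z → z = comb Z c ⊔ y := by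
      intro s c y hs hcz h0 hle
      have hs0 : s = 0 := hs.antisymm (h0.trans (by simpa using add_le_add_right hcz s))
      rw [hs0, zero_add] at h0
      rw [hs0, scale_eq_vadd, zero_vadd] at hle
      refine le_antisymm (le_trans ?_ le_sup_left) hle
      exact (zero_vadd Scalar z).symm.le.trans ((vadd_le_vadd h0 z).trans (vadd_le_comb hz c))
    rcases le_sup_iff.mp h1 with h3 | h3
    · exact Or.inl (h2 s c y hs hcle h3 (le_sup_left.trans huw.ge))
    · exact Or.inr (h2 t d y' ht hdle h3 (le_sup_right.trans huw.ge))

theorem minimal_points_iff {n : ℕ} {C : Set (Vec n)} (hC : ∃ Z Y, IsRepresentation C Z Y)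
    {Z : Set (Vec n)} :
    Minimal (fun Z' => ∃ Y, IsRepresentation C Z' Y) Z ↔ Z = extremePoints C := by
  have key : ∀ {Z}, Minimal (fun Z' => ∃ Y, IsRepresentation C Z' Y) Z → Z = extremePoints C := by
    intro Z h
    obtain ⟨Y, hY⟩ := h.prop
    exact (subset_extremePoints_of_minimal h).antisymm (extremePoints_subset_of_isRepresentation hY)
  refine ⟨key, ?_⟩
  rintro rfl
  obtain ⟨Z₀, Y₀, h₀⟩ := hC
  obtain ⟨Z₁, -, hZ₁⟩ := exists_minimal_subset (P := fun Z' => ∃ Y, IsRepresentation C Z' Y)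
    h₀.1 ⟨Y₀, h₀⟩
  exact key hZ₁ ▸ hZ₁

end MaxPlus

theorem theorem2p2 (n : ℕ) :
    (∀ C : Set (MaxPlus.Vec n),
      MaxPlus.IsPolyhedron C ↔ ∃ Z Y, MaxPlus.IsRepresentation C Z Y) ∧
    (∀ C Z Y : Set (MaxPlus.Vec n), C.Nonempty → MaxPlus.IsRepresentation C Z Y →
      MaxPlus.cone Y = MaxPlus.recessionCone C) ∧
    (∀ C : Set (MaxPlus.Vec n), MaxPlus.IsPolyhedron C → ∀ Y : Set (MaxPlus.Vec n),
      Minimal (fun Y' => ∃ Z, MaxPlus.IsRepresentation C Z Y') Y ↔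
        MaxPlus.IsExtremeRaySelection (MaxPlus.recessionCone C) Y) ∧
    (∀ C : Set (MaxPlus.Vec n), MaxPlus.IsPolyhedron C → ∀ Z : Set (MaxPlus.Vec n),
      Minimal (fun Z' => ∃ Y, MaxPlus.IsRepresentation C Z' Y) Z ↔
        Z = MaxPlus.extremePoints C) := by
  refine ⟨fun C => MaxPlus.isPolyhedron_iff_exists_isRepresentation,
    fun C Z Y hC h => MaxPlus.cone_eq_recessionCone hC h, fun C hC Y => ?_, fun C hC Z => ?_⟩
  · exact MaxPlus.minimal_vectors_iff (MaxPlus.isPolyhedron_iff_exists_isRepresentation.mp hC)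
  · exact MaxPlus.minimal_points_iff (MaxPlus.isPolyhedron_iff_exists_isRepresentation.mp hC)
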